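/- Let $\mathbb T=\{z\in\mathbb C: |z|=1\}\simeq\mathbb R/2\pi\mathbb Z$. For $f\in L^2(\mathbb T)$ write $f(\mathrm e^{\mathrm i x})=\sum_{n\in\mathbb Z}\widehat f(n)\mathrm e^{\mathrm i nx}$, let $P_+f(\mathrm e^{\mathrm i x})=\sum_{n\ge 0}\widehat f(n)\mathrm e^{\mathrm i nx}$, $H^2=P_+L^2(\mathbb T)$, $|D|f(\mathrm e^{\mathrm i x})=\sum_{n}|n|\widehat f(n)\mathrm e^{\mathrm i nx}$, and $S(t)f(\mathrm e^{\mathrm i x})=\sum_n \mathrm e^{-|n|t}\widehat f(n)\mathrm e^{\mathrm i nx}$ for $t\ge0$. Let $\omega\subset\mathbb T$ be an interval (a nonempty connected subset). For $f_0\in H^2$, $T>0$ and a control $u\in L^2([0,T]\times\omega)=L^2(0,T;L^2(\omega))$, the solution on $[0,T]$ of $$(\partial_t+|D|)f=P_+\mathbf 1_\omega u,\qquad f(0)=f_0,$$ is the mild solution $f(t)=S(t)f_0+\int_0^tS(t-s)P_+\mathbf 1_\omega u(s)\,\mathrm ds$. Put $\mathcal F_T^+u=\int_0^TS(T-s)P_+\mathbf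 1_\omega u(s)\,\mathrm ds$, and let $\mathrm{NC}_{H^2}(\omega,T)$ be the set of $f_0\in H^2$ for which there is $u\in L^2([0,T]\times\omega)$ whose solution $f$ satisfies $f(T)=0$. (i) For all $T,T'>0$, $\mathrm{NC}_{H^2}(\omega,T)=\mathrm{NC}_{H^2}(\omega,T')$. (ii) Let $T>0$ and $f_0\in\mathrm{NC}_{H^2}(\omega,T)$. There exists $C>0$ such that for every $T'>0$ there exists $u\in L^2([0,T']\times\omega)$ with $$S(T')f_0+\mathcal F_{T'}^+u=0\qquad\text{and}\qquad \|u\|_{L^2([0,T']\times\omega)}\le C\max(1,T'^{-3/2}).$$ -/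

import Mathlib

open MeasureTheory AddCircle Set
open scoped ENNReal Real

namespace HalfHeat

instance factTwoPiPos : Fact ((0 : ℝ) < 2 * π) := ⟨Real.two_pi_pos⟩

/-- The circle `𝕋`, identified with `ℝ / 2πℤ` through `x ↦ e^{ix}`. -/
abbrev Torus : Type := AddCircle (2 * π)

/-- The arc-length measure on the circle, normalised as `dx / 2π`. With this normalisation
`fourierCoeff f n` is the coefficient of `e^{inx}` in `f`. Using `dx` instead gives the same
`L²` spaces, with norms multiplied by the constant `√(2π)`. -/
noncomputable abbrev arcMeasure : Measure Torus := haarAddCircle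

/-- The space `L²(𝕋)` of complex-valued functions. -/
noncomputable abbrev L2T : Type := Lp ℂ 2 arcMeasure

theorem memℓp_mul_of_norm_le_one (m : ℤ → ℂ) (hm : ∀ n, ‖m n‖ ≤ 1)
    (a : lp (fun _ : ℤ => ℂ) 2) : Memℓp (fun n => m n * a n) 2 := by
  have hp : 0 < (2 : ℝ≥0∞).toReal := by norm_num
  refine memℓp_gen (((memℓp_gen_iff hp).1 (lp.memℓp a)).of_nonneg_of_le
    (fun n => by positivity) fun n => ?_)
  refine Real.rpow_le_rpow (norm_nonneg _) ?_ hp.le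
  rw [norm_mul]
  exact mul_le_of_le_one_left (norm_nonneg _) (hm n)

/-- Multiplication of a square summable sequence by a sequence bounded by `1`. -/
noncomputable def seqMul (m : ℤ → ℂ) (hm : ∀ n, ‖m n‖ ≤ 1) :
    lp (fun _ : ℤ => ℂ) 2 →L[ℂ] lp (fun _ : ℤ => ℂ) 2 :=
  LinearMap.mkContinuous
    { toFun := fun a => ⟨fun n => m n * a n, memℓp_mul_of_norm_le_one m hm a⟩
      map_add' := fun a b => by ext n; exact mul_add (m n) (a n) (b n)
      map_smul' := fun c a => by ext n; exact mul_left_comm (m n) c (a n) } 1 (by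
    intro a
    have hp : 0 < (2 : ℝ≥0∞).toReal := by norm_num
    rw [one_mul]
    refine lp.norm_le_of_tsum_le hp (norm_nonneg _) ?_
    rw [lp.norm_rpow_eq_tsum hp a]
    have h1 := (memℓp_gen_iff hp).1 (memℓp_mul_of_norm_le_one m hm a)
    have h2 := (memℓp_gen_iff hp).1 (lp.memℓp a)
    refine h1.tsum_le_tsum (fun n => ?_) h2
    refine Real.rpow_le_rpow (norm_nonneg _) ?_ hp.le
    exact (norm_mul (m n) (a n)).trans_le (mul_le_of_le_one_left (norm_nonneg _) (hm n)))

/-- The Fourier multiplier `∑ f̂(n) e^{inx} ↦ ∑ m(n) f̂(n) e^{inx}` on `L²(𝕋)`. -/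
noncomputable def fourierMultiplier (m : ℤ → ℂ) (hm : ∀ n, ‖m n‖ ≤ 1) : L2T →L[ℂ] L2T :=
  fourierBasis.repr.symm.toContinuousLinearEquiv.toContinuousLinearMap ∘L
    seqMul m hm ∘L fourierBasis.repr.toContinuousLinearEquiv.toContinuousLinearMap

theorem fourierCoeff_fourierMultiplier (m : ℤ → ℂ) (hm : ∀ n, ‖m n‖ ≤ 1) (f : L2T) (n : ℤ) :
    fourierCoeff (fourierMultiplier m hm f) n = m n * fourierCoeff f n := by
  rw [← fourierBasis_repr, ← fourierBasis_repr]
  simp [fourierMultiplier, seqMul]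

/-- The Riesz projector `P₊`, which keeps the frequencies `n ≥ 0`. -/
noncomputable def rieszProj : L2T →L[ℂ] L2T :=
  fourierMultiplier (fun n => if 0 ≤ n then 1 else 0) (fun n => by split_ifs <;> simp)

/-- The Hardy space `H² = P₊ L²(𝕋)`. -/
noncomputable def hardyH2 : Submodule ℂ L2T := (rieszProj : L2T →ₗ[ℂ] L2T).range

/-- The semigroup `S(t)` generated by `-|D|`: it multiplies the `n`-th Fourier coefficient by
`e^{-|n|t}`. Only times `t ≥ 0` matter; `S(t)` is the identity for `t < 0`. -/
noncomputable def semigroup (t : ℝ) : L2T →L[ℂ] L2T :=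
  fourierMultiplier (fun n => (Real.exp (-(|(n : ℝ)| * max t 0)) : ℂ)) (fun n => by
    rw [Complex.norm_real, Real.norm_eq_abs, Real.abs_exp, Real.exp_le_one_iff, neg_nonpos]
    positivity)

theorem fourierCoeff_semigroup {t : ℝ} (ht : 0 ≤ t) (f : L2T) (n : ℤ) :
    fourierCoeff (semigroup t f) n = (Real.exp (-(|(n : ℝ)| * t)) : ℂ) * fourierCoeff f n := by
  rw [semigroup, fourierCoeff_fourierMultiplier, max_eq_left ht]

/-- The space `L²(ω)`. -/
noncomputable abbrev L2On (ω : Set Torus) : Type := Lp ℂ 2 (arcMeasure.restrict ω)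

/-- The space `L²(0,T; L²(ω))`, that is `L²([0,T] × ω)`, of controls. -/
noncomputable abbrev Control (ω : Set Torus) (T : ℝ) : Type :=
  Lp (L2On ω) 2 ((volume : Measure ℝ).restrict (Icc 0 T))

open scoped Classical in
/-- The extension `𝟙_ω g ∈ L²(𝕋)` of `g ∈ L²(ω)` by zero. For measurable `ω`, the first case
always applies. -/
noncomputable def extendByZero (ω : Set Torus) (g : L2On ω) : L2T :=
  if h : MemLp (ω.indicator g) 2 arcMeasure then h.toLp (ω.indicator g) else 0

theorem memLp_indicator {ω : Set Torus} (hω : MeasurableSet ω) (g : L2On ω) :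
    MemLp (ω.indicator g) 2 arcMeasure :=
  (memLp_indicator_iff_restrict hω).2 (Lp.memLp g)

/-- The input-to-output map
`u ↦ ∫₀ᵗ S(t - s) P₊ 𝟙_ω u(s) ds`, for a control `u` on `[0,T]` and a time `t ∈ [0,T]`. -/
noncomputable def inputToOutput (ω : Set Torus) (T : ℝ) (u : Control ω T) (t : ℝ) : L2T :=
  ∫ s in (0 : ℝ)..t, semigroup (t - s) (rieszProj (extendByZero ω (u s)))

/-- `f` is the (mild) solution on `[0,T]` of the control system
`(∂ₜ + |D|) f = P₊ 𝟙_ω u`, `f(0) = f₀`. -/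
def IsSolution (ω : Set Torus) (T : ℝ) (f₀ : L2T) (u : Control ω T) (f : ℝ → L2T) : Prop :=
  ∀ t ∈ Icc (0 : ℝ) T, f t = semigroup t f₀ + inputToOutput ω T u t

/-- The set of `f₀ ∈ H²` that are steerable to `0` in `H²` from `ω` in time `T`. -/
def NCH2 (ω : Set Torus) (T : ℝ) : Set L2T :=
  {f₀ | f₀ ∈ hardyH2 ∧ ∃ (u : Control ω T) (f : ℝ → L2T), IsSolution ω T f₀ u f ∧ f T = 0}

end HalfHeat

/-!
On the Fourier side the controlled equation reads `f_n' = -|n| f_n + g_n` for `n ≥ 0`, with source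
`g = 𝟙_ω u` extended by zero outside `[0, T]`. Given a null-control `u` in time `T`, solve instead
the transport equation `(∂ₜ - i ∂ₓ) h = g` for *all* frequencies, backward from `h(T) = 0`. For
`n ≥ 0` this recovers the controlled state, so `h_n(0) = f₀_n` (null-controllability is exactly this
identity), and for `n < 0` the backward equation is stable. Hence `h` is bounded with values in
`L²(𝕋)` (`norm_backwardCoeff_le`, `summable_sq_integral_coeff`).

The equation says that `h` is holomorphic in `x + i t` away from `ω`, and `h` vanishes for `t ≥ T`.
By unique continuation `h` is supported in the closure of `ω` at all positive times
(`backward_eq_zero_off_closure`); this exceeds `ω` by a null set, because `ω` is an interval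
(`measurableSet_and_ae_closure`). The regularity needed for unique continuation is gained by
pairing `h` with the translates of a test function (`tsum_eq_zero_of_transport`).

Now let `θ` decrease linearly from `1` to `0` on `[0, T₁]`, with `T₁ = min T T'`. Then `θ h` solves
the transport equation with source `θ g + θ' h`, which is supported in `ω`, and it goes from `h(0)`
to `0` in time `T₁`. So `θ u + θ' h` is a null-control in time `T'`
(`exists_control_of_null_control`). As `|θ'| = 1 / T₁`, its norm is at most a constant times
`max(1, 1 / T')`, which is better than the required `max(1, T'^(-3/2))`.
-/

namespace HalfHeat

/-! ### Integration by parts and unique continuation -/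

/-- Integration by parts against a primitive of a merely integrable function. -/
theorem integral_deriv_mul_primitive {a b : ℝ} (hab : a ≤ b) {k φ φ' : ℝ → ℂ} (K : ℂ)
    (hk : IntervalIntegrable k volume a b) (hφ : ∀ s, HasDerivAt φ (φ' s) s)
    (hφ' : Continuous φ') :
    ∫ s in a..b, (φ' s * (K + ∫ r in a..s, k r) + φ s * k s) =
      φ b * (K + ∫ r in a..b, k r) - φ a * K := by
  have hφc : Continuous φ := continuous_iff_continuousAt.2 fun s => (hφ s).continuousAt
  have hK : ContinuousOn (fun s => ∫ r in a..s, k r) (uIcc a b) :=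
    intervalIntegral.continuousOn_primitive_interval' hk left_mem_uIcc
  have hftc : ∀ x y, ∫ s in x..y, φ' s = φ y - φ x := fun x y =>
    intervalIntegral.integral_eq_sub_of_hasDerivAt (fun s _ => hφ s)
      (hφ'.intervalIntegrable _ _)
  have i1 : IntervalIntegrable (fun s => φ' s * K) volume a b :=
    (hφ'.mul continuous_const).intervalIntegrable _ _
  have i2 : IntervalIntegrable (fun s => φ' s * ∫ r in a..s, k r) volume a b :=
    (hφ'.continuousOn.mul hK).intervalIntegrable
  have i3 : IntervalIntegrable (fun s => φ s * k s) volume a b :=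
    hk.continuousOn_mul hφc.continuousOn
  -- Exchanging the order of integration over the triangle `a < r ≤ s ≤ b`.
  have key : ∫ s in a..b, φ' s * ∫ r in a..s, k r = ∫ r in a..b, (φ b - φ r) * k r := by
    have hk' : Integrable k (volume.restrict (Ioc a b)) := hk.1
    have hφi : Integrable φ' (volume.restrict (Ioc a b)) :=
      (hφ'.intervalIntegrable a b).1
    have hint : Integrable (Function.uncurry fun s r => (Iic s).indicator k r * φ' s)
        ((volume.restrict (Ioc a b)).prod (volume.restrict (Ioc a b))) := by
      have h1 : Integrable (fun z : ℝ × ℝ => φ' z.1 * k z.2)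
        ((volume.restrict (Ioc a b)).prod (volume.restrict (Ioc a b))) := hφi.mul_prod hk'
      have h2 := h1.indicator (s := {z : ℝ × ℝ | z.2 ≤ z.1})
        (measurableSet_le measurable_snd measurable_fst)
      refine h2.congr (.of_forall fun z => ?_)
      by_cases hz : z.2 ≤ z.1 <;> simp [Function.uncurry, indicator, hz, mul_comm]
    have hswap := integral_integral_swap hint
    rw [intervalIntegral.integral_of_le hab, intervalIntegral.integral_of_le hab]
    calc _ = ∫ s in Ioc a b, ∫ r in Ioc a b, (Iic s).indicator k r * φ' s := by
          refine setIntegral_congr_fun measurableSet_Ioc fun s hs => ?_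
          rw [integral_mul_const, integral_indicator measurableSet_Iic,
            Measure.restrict_restrict measurableSet_Iic, mul_comm,
            intervalIntegral.integral_of_le hs.1.le]
          congr 3
          ext r; simp only [mem_Ioc, mem_inter_iff, mem_Iic]
          constructor
          · rintro ⟨h1, h2⟩; exact ⟨h2, h1, h2.trans hs.2⟩
          · rintro ⟨h1, h2, h3⟩; exact ⟨h2, h1⟩
      _ = _ := hswap
      _ = _ := by
          refine setIntegral_congr_fun measurableSet_Ioc fun r hr => ?_
          have : ∀ s, (Iic s).indicator k r * φ' s = k r * (Ici r).indicator φ' s := by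
            intro s
            by_cases h : r ≤ s <;> simp [indicator, h]
          simp_rw [this]
          rw [integral_const_mul, integral_indicator measurableSet_Ici,
            Measure.restrict_restrict measurableSet_Ici, mul_comm, ← hftc r b,
            intervalIntegral.integral_of_le hr.2, ← integral_Icc_eq_integral_Ioc]
          congr 3
          ext s; simp only [mem_Icc, mem_inter_iff, mem_Ici, mem_Ioc]
          constructor
          · rintro ⟨h1, h2, h3⟩; exact ⟨h1, h3⟩
          · rintro ⟨h1, h2⟩; exact ⟨h1, hr.1.trans_le h1, h2⟩
  have e1 : ∀ s, φ' s * (K + ∫ r in a..s, k r) + φ s * k s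
      = φ' s * K + φ' s * (∫ r in a..s, k r) + φ s * k s := fun s => by ring
  simp_rw [e1]
  rw [intervalIntegral.integral_add (i1.add i2) i3, intervalIntegral.integral_add i1 i2, key,
    intervalIntegral.integral_mul_const, hftc]
  simp_rw [sub_mul]
  rw [intervalIntegral.integral_sub (hk.const_mul _) i3, intervalIntegral.integral_const_mul]
  ring

/-- If `∂ₜ P = i ∂ₓ P` near a point, with continuous partial derivatives, then `P` is complex
differentiable there as a function of `x + i t`. -/
theorem hasDerivAt_complex_of_partial {P Q : ℝ → ℝ → ℂ} {x₀ t₀ : ℝ}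
    (hx : ∀ x t, HasDerivAt (fun y => P y t) (Q x t) x)
    (ht : ∀ᶠ v : ℝ × ℝ in nhds (x₀, t₀),
      HasDerivAt (fun s => P v.1 s) (Complex.I * Q v.1 v.2) v.2)
    (hQ : Continuous (Function.uncurry Q)) :
    HasDerivAt (fun z : ℂ => P z.re z.im) (Q x₀ t₀) (x₀ + t₀ * Complex.I) := by
  have hL : Continuous fun c : ℂ => ContinuousLinearMap.toSpanSingleton ℝ c :=
    (ContinuousLinearMap.toSpanSingletonLIE ℝ ℂ).continuous
  have h := hasStrictFDerivAt_uncurry_coprod (𝕜 := ℝ) (u := (x₀, t₀)) (f := P)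
    (f₁ := fun x t => ContinuousLinearMap.toSpanSingleton ℝ (Q x t))
    (f₂ := fun x t => ContinuousLinearMap.toSpanSingleton ℝ (Complex.I * Q x t))
    (.of_forall fun v => (hx v.1 v.2).hasFDerivAt) (ht.mono fun v hv => hv.hasFDerivAt)
    (hL.comp hQ).continuousAt (hL.comp (continuous_const.mul hQ)).continuousAt
  have h1 : HasFDerivAt (fun v : ℝ × ℝ => P v.1 v.2)
      ((ContinuousLinearMap.toSpanSingleton ℝ (Q x₀ t₀)).coprod
        (ContinuousLinearMap.toSpanSingleton ℝ (Complex.I * Q x₀ t₀))) (x₀, t₀) := h.hasFDerivAt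
  have hc : HasFDerivAt (fun z : ℂ => (z.re, z.im))
      (Complex.reCLM.prod Complex.imCLM) ((x₀ : ℂ) + t₀ * Complex.I) :=
    (Complex.reCLM.prod Complex.imCLM).hasFDerivAt
  have hp : (((x₀ : ℂ) + t₀ * Complex.I).re, ((x₀ : ℂ) + t₀ * Complex.I).im) = (x₀, t₀) := by
    simp
  rw [← hp] at h1
  have h2 : HasFDerivAt (fun z : ℂ => P z.re z.im) _ ((x₀ : ℂ) + t₀ * Complex.I) :=
    HasFDerivAt.comp (g := fun v : ℝ × ℝ => P v.1 v.2) ((x₀ : ℂ) + t₀ * Complex.I) h1 hc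
  rw [hasDerivAt_iff_hasFDerivAt]
  refine hasFDerivAt_of_restrictScalars ℝ h2 ?_
  ext z
  change z * Q x₀ t₀ = z.re • Q x₀ t₀ + z.im • (Complex.I * Q x₀ t₀)
  conv_lhs => rw [← Complex.re_add_im z]
  simp only [Complex.real_smul]
  ring

/-- Unique continuation across the time `T`: a holomorphic function of `x + i t` in the strip
`|x| < η`, `t > 0` which vanishes for `t ≥ T` is zero. -/
theorem eq_zero_of_eq_zero_above {F : ℂ → ℂ} {η T : ℝ} (hη : 0 < η)
    (hF : ∀ z : ℂ, |z.re| < η → 0 < z.im → DifferentiableAt ℂ F z)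
    (h0 : ∀ z : ℂ, T ≤ z.im → F z = 0) {z : ℂ} (hz : |z.re| < η) (hz' : 0 < z.im) :
    F z = 0 := by
  set U : Set ℂ := {z | |z.re| < η} ∩ {z | 0 < z.im} with hU
  have hUo : IsOpen U := (isOpen_lt (by fun_prop) (by fun_prop)).inter
    (isOpen_lt (by fun_prop) (by fun_prop))
  have hUc : Convex ℝ U := by
    refine Convex.inter ?_ (convex_halfSpace_im_gt 0)
    have : {z : ℂ | |z.re| < η} = {z : ℂ | -η < z.re} ∩ {z : ℂ | z.re < η} := by
      ext z; simp [abs_lt]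
    rw [this]
    exact (convex_halfSpace_re_gt _).inter (convex_halfSpace_re_lt _)
  have hA : AnalyticOnNhd ℂ F U := DifferentiableOn.analyticOnNhd
    (fun z hz => (hF z hz.1 hz.2).differentiableWithinAt) hUo
  have hw : (⟨0, max T 0 + 1⟩ : ℂ) ∈ U := ⟨by simpa using hη, by
    have := le_max_right T 0
    simp only [mem_ofPred_eq]; linarith⟩
  refine hA.eqOn_zero_of_preconnected_of_eventuallyEq_zero hUc.isPreconnected hw ?_ ⟨hz, hz'⟩
  have hn : {z : ℂ | T < z.im} ∈ nhds (⟨0, max T 0 + 1⟩ : ℂ) :=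
    (isOpen_lt continuous_const Complex.continuous_im).mem_nhds (by
      have := le_max_left T 0
      simp only [mem_ofPred_eq]; linarith)
  filter_upwards [hn] with z hz using h0 z (le_of_lt hz)

theorem norm_exp_I_mul_int_mul (n : ℤ) (x : ℝ) : ‖Complex.exp (Complex.I * n * x)‖ = 1 := by
  have : Complex.I * n * x = ((n * x : ℝ) : ℂ) * Complex.I := by push_cast; ring
  rw [this, Complex.norm_exp_ofReal_mul_I]

/-- Unique continuation for the transport system `c' = -n c + γ`, the Fourier side of
`(∂ₜ - i ∂ₓ) h = g`. The weights `a` are the Fourier coefficients of a test function, so that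
`P x t = ∑ aₙ cₙ(t) e^{inx}` is the pairing of `h t` with the translates of the test function.
If these translates do not meet the support of `g`, then `P` is holomorphic in `x + i t`. -/
theorem tsum_eq_zero_of_transport {c γ : ℤ → ℝ → ℂ} {a : ℤ → ℂ} {G : ℝ → ℝ} {M T η : ℝ}
    (hη : 0 < η) (hc : ∀ n, Continuous (c n)) (hM : ∀ n t, ‖c n t‖ ≤ M)
    (hT : ∀ n t, T ≤ t → c n t = 0) (hγ : ∀ n, AEStronglyMeasurable (γ n))
    (hG : Integrable G) (hγG : ∀ n s, ‖γ n s‖ ≤ G s)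
    (hode : ∀ n t, 0 ≤ t → c n t - c n 0 = ∫ s in (0 : ℝ)..t, (-n * c n s + γ n s))
    (ha : Summable fun n : ℤ => ‖a n‖) (ha' : Summable fun n : ℤ => ‖(n : ℂ) * a n‖)
    (h0 : ∀ x : ℝ, |x| < η → ∀ s, ∑' n, a n * γ n s * Complex.exp (Complex.I * n * x) = 0)
    {t : ℝ} (ht : 0 < t) : ∑' n, a n * c n t = 0 := by
  have hne := norm_exp_I_mul_int_mul
  set P : ℝ → ℝ → ℂ := fun x t => ∑' n, a n * c n t * Complex.exp (Complex.I * n * x) with hP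
  set Q : ℝ → ℝ → ℂ := fun x t => ∑' n, Complex.I * (n * a n) * c n t *
    Complex.exp (Complex.I * n * x) with hQ
  have hPb : ∀ (n : ℤ) (x t : ℝ), ‖a n * c n t * Complex.exp (Complex.I * n * x)‖ ≤ ‖a n‖ * M := by
    intro n x t
    rw [norm_mul, norm_mul, hne, mul_one]
    exact mul_le_mul_of_nonneg_left (hM n t) (norm_nonneg _)
  have hQb : ∀ (n : ℤ) (x t : ℝ),
      ‖Complex.I * (n * a n) * c n t * Complex.exp (Complex.I * n * x)‖ ≤
      ‖(n : ℂ) * a n‖ * M := by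
    intro n x t
    rw [norm_mul, norm_mul, hne, mul_one, norm_mul, Complex.norm_I, one_mul]
    exact mul_le_mul_of_nonneg_left (hM n t) (norm_nonneg _)
  have hPs : ∀ x t : ℝ, Summable fun n => a n * c n t * Complex.exp (Complex.I * n * x) :=
    fun x t => Summable.of_norm_bounded (ha.mul_right M) fun n => hPb n x t
  have hQs : ∀ x t : ℝ, Summable fun n => Complex.I * (n * a n) * c n t *
      Complex.exp (Complex.I * n * x) :=
    fun x t => Summable.of_norm_bounded (ha'.mul_right M) fun n => hQb n x t
  have hQc : Continuous (Function.uncurry Q) := by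
    refine continuous_tsum (fun n => ?_) (ha'.mul_right M) fun n v => hQb n v.1 v.2
    have := (hc n).comp (continuous_snd (X := ℝ) (Y := ℝ))
    simp only [Function.comp_def] at this
    fun_prop
  have hx : ∀ x t, HasDerivAt (fun y => P y t) (Q x t) x := by
    intro x t
    refine hasDerivAt_tsum (ha'.mul_right M) (fun n y => ?_) (fun n y => hQb n y t) (hPs 0 t) x
    have h1 : HasDerivAt (fun y : ℝ => Complex.exp (Complex.I * n * y))
        (Complex.exp (Complex.I * n * y) * (Complex.I * n * 1)) y :=
      ((Complex.ofRealCLM.hasDerivAt (x := y)).const_mul (Complex.I * n)).cexp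
    exact (h1.const_mul (a n * c n t)).congr_deriv (by ring)
  -- The integrated equation in time; the source term has dropped out.
  have hint : ∀ x, |x| < η → ∀ t, 0 ≤ t →
      P x t = P x 0 + ∫ s in (0 : ℝ)..t, Complex.I * Q x s := by
    intro x hxη t ht
    have hsum : HasSum (fun n => ∫ s in (0 : ℝ)..t,
        a n * (-n * c n s + γ n s) * Complex.exp (Complex.I * n * x))
        (∫ s in (0 : ℝ)..t, Complex.I * Q x s) := by
      refine intervalIntegral.hasSum_integral_of_dominated_convergence
        (fun n s => ‖(n : ℂ) * a n‖ * M + ‖a n‖ * G s) (fun n => ?_) (fun n => .of_forall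
        fun s _ => ?_) (.of_forall fun s _ => (ha'.mul_right M).add (ha.mul_right (G s))) ?_
        (.of_forall fun s _ => ?_)
      · exact ((((continuous_const.mul (hc n)).aestronglyMeasurable).add
          (hγ n).restrict).const_mul _).mul_const _
      · rw [norm_mul, hne, mul_one]
        calc ‖a n * (-n * c n s + γ n s)‖ = ‖-(n * a n) * c n s + a n * γ n s‖ := by ring_nf
          _ ≤ ‖(n : ℂ) * a n‖ * ‖c n s‖ + ‖a n‖ * ‖γ n s‖ := by
            refine (norm_add_le _ _).trans_eq ?_
            rw [norm_mul, norm_neg, norm_mul (a n)]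
          _ ≤ _ := by gcongr; exacts [hM n s, hγG n s]
      · have : (fun s => ∑' n : ℤ, (‖(n : ℂ) * a n‖ * M + ‖a n‖ * G s)) =
            fun s => (∑' n : ℤ, ‖(n : ℂ) * a n‖ * M) + (∑' n, ‖a n‖) * G s := by
          ext s
          rw [(ha'.mul_right M).tsum_add (ha.mul_right (G s)), tsum_mul_right (a := G s)]
        rw [this]
        exact intervalIntegrable_const.add (hG.intervalIntegrable.const_mul _)
      · have hγs : Summable fun n => a n * γ n s * Complex.exp (Complex.I * n * x) := by
          refine Summable.of_norm_bounded (ha.mul_right (G s)) fun n => ?_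
          rw [norm_mul, norm_mul, hne, mul_one]
          exact mul_le_mul_of_nonneg_left (hγG n s) (norm_nonneg _)
        have h1 := ((hQs x s).hasSum.mul_left Complex.I).add hγs.hasSum
        rw [h0 x hxη s, add_zero] at h1
        convert! h1 using 1
        funext n
        linear_combination -(n * a n * c n s * Complex.exp (Complex.I * n * x)) * Complex.I_mul_I
    have hsum2 := (hPs x t).hasSum.sub (hPs x 0).hasSum
    have heq : (fun n => ∫ s in (0 : ℝ)..t,
        a n * (-n * c n s + γ n s) * Complex.exp (Complex.I * n * x)) =
        fun n => a n * c n t * Complex.exp (Complex.I * n * x) -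
          a n * c n 0 * Complex.exp (Complex.I * n * x) := by
      ext n
      rw [intervalIntegral.integral_mul_const, intervalIntegral.integral_const_mul,
        ← hode n t ht]
      ring
    rw [heq] at hsum
    rw [← hsum2.unique hsum]
    simp [hP]
  have htd : ∀ x, |x| < η → ∀ t, 0 < t → HasDerivAt (fun s => P x s) (Complex.I * Q x t) t := by
    intro x hxη t ht
    have hcont : Continuous fun s => Complex.I * Q x s :=
      continuous_const.mul (hQc.comp (Continuous.prodMk continuous_const continuous_id))
    have h1 := (hcont.integral_hasStrictDerivAt 0 t).hasDerivAt.const_add (P x 0)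
    refine h1.congr_of_eventuallyEq ?_
    filter_upwards [lt_mem_nhds ht] with s hs using hint x hxη s hs.le
  have hhol : ∀ z : ℂ, |z.re| < η → 0 < z.im →
      DifferentiableAt ℂ (fun z : ℂ => P z.re z.im) z := by
    intro z hz hz'
    have h1 := hasDerivAt_complex_of_partial (P := P) (Q := Q) (x₀ := z.re) (t₀ := z.im) hx ?_ hQc
    · rw [Complex.re_add_im] at h1
      exact h1.differentiableAt
    · have : IsOpen ({v : ℝ × ℝ | |v.1| < η} ∩ {v | 0 < v.2}) :=
        (isOpen_lt (by fun_prop) (by fun_prop)).inter (isOpen_lt (by fun_prop) (by fun_prop))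
      filter_upwards [this.mem_nhds ⟨hz, hz'⟩] with v hv using htd v.1 hv.1 v.2 hv.2
  have hfin := eq_zero_of_eq_zero_above (T := T) hη hhol (fun z hz => by
    simp [hP, hT _ _ hz]) (z := ⟨0, t⟩) (by simpa using hη) ht
  simpa [hP] using hfin

/-! ### Pairing with test functions -/

theorem fourier_coe_eq_exp (n : ℤ) (y : ℝ) :
    fourier n (y : Torus) = Complex.exp (Complex.I * n * y) := by
  rw [fourier_coe_apply]
  congr 1
  have : (π : ℂ) ≠ 0 := by exact_mod_cast Real.pi_ne_zero
  push_cast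
  field_simp

open scoped ContDiff in
/-- The coefficients `∫ q(y) e^{iny} dy` of a test function are absolutely summable, together with
those of its derivative, since they sample a Schwartz function. -/
theorem summable_coeff_of_contDiff {q : ℝ → ℝ} (hq : ContDiff ℝ ∞ q) (hqc : HasCompactSupport q) :
    (Summable fun n : ℤ => ‖∫ y, (q y : ℂ) * Complex.exp (Complex.I * n * y)‖) ∧
    Summable fun n : ℤ => ‖(n : ℂ) * ∫ y, (q y : ℂ) * Complex.exp (Complex.I * n * y)‖ := by
  have h1 : ContDiff ℝ ∞ fun y => (q y : ℂ) := Complex.ofRealCLM.contDiff.comp hq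
  have h2 : HasCompactSupport fun y => (q y : ℂ) := hqc.comp_left Complex.ofReal_zero
  set F := FourierTransform.fourier (h2.toSchwartzMap h1) with hF
  have hFa : ∀ n : ℤ, ∫ y, (q y : ℂ) * Complex.exp (Complex.I * n * y) = F (-(n / (2 * π))) := by
    intro n
    rw [hF, SchwartzMap.fourier_coe, Real.fourier_eq']
    congr 1
    ext y
    have hpi : (π : ℂ) ≠ 0 := by exact_mod_cast Real.pi_ne_zero
    simp only [HasCompactSupport.toSchwartzMap_toFun, smul_eq_mul]
    rw [mul_comm]
    congr 2
    simp only [RCLike.inner_apply, conj_trivial]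
    push_cast
    field_simp
  obtain ⟨C, hC, hCF⟩ := F.decay 3 0
  have hS : Summable fun n : ℤ => C * (2 * π) ^ 3 * (1 / (n : ℝ) ^ 2) :=
    (Real.summable_one_div_int_pow.2 one_lt_two).mul_left _
  have hev : ∀ᶠ n : ℤ in Filter.cofinite, n ≠ 0 := (Set.finite_singleton (0 : ℤ)).compl_mem_cofinite
  have hbd : ∀ n : ℤ, n ≠ 0 →
      ‖(n : ℂ) * ∫ y, (q y : ℂ) * Complex.exp (Complex.I * n * y)‖ ≤
        C * (2 * π) ^ 3 * (1 / (n : ℝ) ^ 2) := by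
    intro n hn
    have h := hCF (-(n / (2 * π)))
    rw [norm_iteratedFDeriv_zero, norm_neg, norm_div, Real.norm_of_nonneg Real.two_pi_pos.le,
      Real.norm_eq_abs, div_pow, div_mul_eq_mul_div, div_le_iff₀ (by positivity)] at h
    have hn' : 0 < |(n : ℝ)| := by positivity
    rw [hFa, norm_mul, Complex.norm_intCast, mul_one_div, le_div_iff₀ (by positivity), ← sq_abs]
    calc _ = |(n : ℝ)| ^ 3 * ‖F (-(n / (2 * π)))‖ := by ring
      _ ≤ _ := h
  have hs2 : Summable fun n : ℤ =>
      ‖(n : ℂ) * ∫ y, (q y : ℂ) * Complex.exp (Complex.I * n * y)‖ := by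
    refine Summable.of_norm_bounded_eventually hS ?_
    filter_upwards [hev] with n hn
    rw [norm_norm]
    exact hbd n hn
  refine ⟨Summable.of_norm_bounded_eventually hs2 ?_, hs2⟩
  filter_upwards [hev] with n hn
  rw [norm_norm, norm_mul, Complex.norm_intCast]
  refine le_mul_of_one_le_left (norm_nonneg _) ?_
  exact_mod_cast Int.one_le_abs hn

/-- A function in `L²` of the circle paired with a test function supported in one period. -/
theorem hasSum_pairing (f : L2T) {q : ℝ → ℝ} (hq : Continuous q)
    (hqs : Function.support q ⊆ Ioc 0 (2 * π)) :
    HasSum (fun n : ℤ => (∫ y, (q y : ℂ) * Complex.exp (Complex.I * n * y)) * fourierCoeff f n)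
      (∫ y, (q y : ℂ) * f (y : Torus)) := by
  set Q : Torus → ℂ := AddCircle.liftIoc (2 * π) 0 fun y => (q y : ℂ) with hQ
  have hqc : HasCompactSupport q :=
    HasCompactSupport.of_support_subset_isCompact isCompact_Icc (hqs.trans Ioc_subset_Icc_self)
  have hQL : MemLp Q 2 arcMeasure := by
    refine memLp_haarAddCircle_iff.2 (MemLp.memLp_liftIoc ?_)
    have h : MemLp (fun y => (q y : ℂ)) 2 volume :=
      (Complex.continuous_ofReal.comp hq).memLp_of_hasCompactSupport
        (hqc.comp_left Complex.ofReal_zero)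
    exact h.restrict _
  have hpi : (2 * π : ℝ) ≠ 0 := Real.two_pi_pos.ne'
  have key : ∀ g : L2T, ∀ g' : Torus → ℂ, g =ᵐ[arcMeasure] g' →
      ((2 * π : ℝ) : ℂ) * inner ℂ (hQL.toLp Q) g = ∫ y, (q y : ℂ) * g' (y : Torus) := by
    intro g g' hg
    rw [L2.inner_def]
    have h1 : ∫ a, inner ℂ (hQL.toLp Q a) (g a) ∂arcMeasure = ∫ a, Q a * g' a ∂arcMeasure := by
      refine integral_congr_ae ?_
      filter_upwards [hg, hQL.coeFn_toLp] with a ha ha'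
      have hr : (starRingEnd ℂ) (Q a) = Q a := by
        simp only [hQ, AddCircle.liftIoc, Function.comp, Set.domRestrict_apply]
        exact Complex.conj_ofReal _
      rw [ha', ha, RCLike.inner_apply', hr]
    rw [h1, integral_haarAddCircle, ← AddCircle.integral_preimage (2 * π) 0, Complex.real_smul,
      ← mul_assoc, ← Complex.ofReal_mul, mul_inv_cancel₀ hpi, Complex.ofReal_one, one_mul,
      zero_add]
    rw [← setIntegral_eq_integral_of_forall_compl_eq_zero (s := Ioc 0 (2 * π))
      (f := fun y : ℝ => (q y : ℂ) * g' (y : Torus))]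
    · refine setIntegral_congr_fun measurableSet_Ioc fun (y : ℝ) hy => ?_
      have : Q (y : Torus) = q y := by
        rw [hQ, liftIoc_coe_apply (by simpa using hy)]
      simp only [this]
    · intro y hy
      have : q y = 0 := by
        by_contra h
        exact hy (hqs h)
      simp [this]
  have h := (((hasSum_fourier_series_L2 f).mapL (innerSL ℂ (hQL.toLp Q))).mul_left
    ((2 * π : ℝ) : ℂ))
  simp only [innerSL_apply_apply, inner_smul_right] at h
  rw [key f f (Filter.EventuallyEq.refl _ _)] at h
  convert! h using 1
  funext n
  have := key (fourierLp 2 n) (fourier n) (coeFn_fourierLp 2 n)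
  simp_rw [fourier_coe_eq_exp] at this
  rw [← this]
  ring

/-- Translating the test function by `x` multiplies its `n`-th coefficient by `e^{inx}`. -/
theorem integral_translate_mul_exp (q : ℝ → ℝ) (n : ℤ) (x : ℝ) :
    ∫ y, (q (y - x) : ℂ) * Complex.exp (Complex.I * n * y) =
      (∫ y, (q y : ℂ) * Complex.exp (Complex.I * n * y)) * Complex.exp (Complex.I * n * x) := by
  rw [← integral_add_right_eq_self _ x, ← integral_mul_const]
  congr 1
  ext y
  rw [add_sub_cancel_right, mul_assoc (q y : ℂ), ← Complex.exp_add]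
  push_cast
  ring_nf

/-- A property valid almost everywhere on the circle is valid almost everywhere along one turn of
the line. -/
theorem ae_coe_of_ae {p : Torus → Prop} (hp : ∀ᵐ x ∂arcMeasure, p x) :
    ∀ᵐ y : ℝ, y ∈ Ioc 0 (2 * π) → p y := by
  have h1 : ∀ᵐ x ∂(volume : Measure Torus), p x := by
    rw [volume_eq_smul_haarAddCircle]
    exact Measure.ae_smul_measure hp _
  have h2 := (AddCircle.measurePreserving_mk (2 * π) 0).quasiMeasurePreserving.ae h1
  rw [zero_add] at h2
  exact (ae_restrict_iff' measurableSet_Ioc).1 h2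

/-- Converse of `ae_coe_of_ae`, with the turn starting at any point `a`. -/
theorem ae_of_ae_coe (a : ℝ) {p : Torus → Prop} (hm : MeasurableSet {x | p x})
    (hp : ∀ᵐ y : ℝ, y ∈ Ioc a (a + 2 * π) → p y) : ∀ᵐ x ∂arcMeasure, p x := by
  have h1 : ∀ᵐ x ∂(volume : Measure Torus), p x := by
    rw [← (AddCircle.measurePreserving_mk (2 * π) a).map_eq,
      ae_map_iff AddCircle.measurable_mk'.aemeasurable hm]
    exact (ae_restrict_iff' measurableSet_Ioc).2 hp
  rw [volume_eq_smul_haarAddCircle] at h1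
  exact (Measure.ae_ennreal_smul_measure_iff (by simp [Real.pi_pos])).1 h1

open scoped ContDiff in
/-- An `L²` function on the circle which vanishes against all test functions in an open set `V`
vanishes almost everywhere in `V`. -/
theorem ae_eq_zero_of_integral_test_eq_zero {V : Set Torus} (hV : IsOpen V) (f : L2T)
    (h : ∀ q : ℝ → ℝ, ContDiff ℝ ∞ q → HasCompactSupport q →
      tsupport q ⊆ (fun y : ℝ => (y : Torus)) ⁻¹' V ∩ Ioo 0 (2 * π) →
      ∫ y, (q y : ℂ) * f (y : Torus) = 0) :
    ∀ᵐ x ∂arcMeasure, x ∈ V → f x = 0 := by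
  have hU : IsOpen ((fun y : ℝ => (y : Torus)) ⁻¹' V ∩ Ioo 0 (2 * π)) :=
    (hV.preimage (AddCircle.continuous_mk' _)).inter isOpen_Ioo
  have hfi : Integrable (f : Torus → ℂ) (volume : Measure Torus) :=
    (memLp_haarAddCircle_iff.1 (Lp.memLp f)).integrable one_le_two
  have hloc : IntegrableOn (fun y : ℝ => f (y : Torus)) (Ioc 0 (2 * π)) := by
    have := (AddCircle.measurePreserving_mk (2 * π) 0).integrable_comp_of_integrable hfi
    rwa [zero_add] at this
  have hz := hU.ae_eq_zero_of_integral_contDiff_smul_eq_zero (μ := volume)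
    (f := fun y : ℝ => f (y : Torus))
    ((hloc.mono_set (inter_subset_right.trans Ioo_subset_Ioc_self)).locallyIntegrableOn)
    (fun q h1 h2 h3 => by simpa [Complex.real_smul] using h q h1 h2 h3)
  refine ae_of_ae_coe 0 ?_ ?_
  · have hfm : Measurable (f : Torus → ℂ) := (Lp.stronglyMeasurable f).measurable
    have : {x | x ∈ V → f x = 0} = Vᶜ ∪ f ⁻¹' {0} := by
      ext x; simp [imp_iff_not_or]
    rw [this]
    exact hV.measurableSet.compl.union (hfm (measurableSet_singleton 0))
  · have hne : ∀ᵐ y : ℝ, y ≠ 2 * π := by simp [ae_iff]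
    filter_upwards [hz, hne] with y hy hy' hy1 hy2
    rw [zero_add] at hy1
    exact hy ⟨hy2, hy1.1, lt_of_le_of_ne hy1.2 hy'⟩

/-! ### Connected subsets of the circle -/

/-- A connected subset of the circle is measurable and its closure exceeds it by a null set. -/
theorem measurableSet_and_ae_closure {ω : Set Torus} (hω : IsConnected ω) :
    MeasurableSet ω ∧ ∀ᵐ x ∂arcMeasure, x ∈ closure ω → x ∈ ω := by
  by_cases huniv : ω = univ
  · simp [huniv]
  obtain ⟨p, hp⟩ := (ne_univ_iff_exists_notMem ω).1 huniv
  obtain ⟨a, rfl⟩ := QuotientAddGroup.mk_surjective p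
  -- Cutting the circle at a point outside `ω` turns `ω` into an interval `J` of the line.
  set e : Torus → ℝ := fun x => (equivIoc (2 * π) a x : ℝ) with he
  have hem : Measurable e := measurable_subtype_coe.comp (measurableEquivIoc (2 * π) a).measurable
  have hinv : ∀ x, ((e x : ℝ) : Torus) = x := fun x => coe_equivIoc
  have hcont : ∀ x : Torus, x ≠ (a : Torus) → ContinuousAt e x := fun x hx =>
    continuous_subtype_val.continuousAt.comp (continuousAt_equivIoc (2 * π) a hx)
  set J := e '' ω with hJ
  have hJc : J.OrdConnected := (hω.isPreconnected.image e fun x hx =>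
    (hcont x (fun h => hp (h ▸ hx))).continuousWithinAt).ordConnected
  have hpre : ω = e ⁻¹' J := by
    refine (subset_preimage_image e ω).antisymm ?_
    rintro x ⟨y, hy, hxy⟩
    rw [← hinv x, ← hxy, hinv y]
    exact hy
  refine ⟨hpre ▸ hem hJc.measurableSet, ?_⟩
  have hfr : volume (frontier J) = 0 := hJc.convex.addHaar_frontier volume
  refine ae_of_ae_coe a ?_ ?_
  · have hm : MeasurableSet ω := hpre ▸ hem hJc.measurableSet
    have : {x | x ∈ closure ω → x ∈ ω} = (closure ω)ᶜ ∪ ω := by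
      ext x; simp [imp_iff_not_or]
    rw [this]
    exact isClosed_closure.measurableSet.compl.union hm
  · have hne : ∀ᵐ y : ℝ, y ≠ a + 2 * π := by simp [ae_iff]
    filter_upwards [measure_eq_zero_iff_ae_notMem.1 hfr, hne] with y hy hya hyI hyc
    have hey : e y = y := equivIoc_coe_of_mem hyI
    have hyp : (y : Torus) ≠ (a : Torus) := by
      intro h
      rw [← AddCircle.coe_add_period (2 * π) a] at h
      exact hya ((coe_eq_coe_iff_of_mem_Ioc hyI
        ⟨lt_add_of_pos_right a Real.two_pi_pos, le_rfl⟩).1 h)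
    by_contra hyω
    refine hy ⟨?_, fun hi => hyω ?_⟩
    · rw [← hey]
      exact (hcont y hyp).continuousWithinAt.mem_closure_image hyc
    · rw [hpre, mem_preimage, hey]
      exact interior_subset hi

/-! ### Fourier coefficients and measurability -/

/-- The `n`-th Fourier coefficient as a continuous functional on `L²`. -/
noncomputable def coeffCLM (n : ℤ) : L2T →L[ℂ] ℂ := innerSL ℂ (fourierBasis n)

theorem coeffCLM_apply (n : ℤ) (f : L2T) : coeffCLM n f = fourierCoeff f n := by
  rw [← fourierBasis_repr, HilbertBasis.repr_apply_apply]
  rfl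

theorem norm_coeffCLM_le (n : ℤ) (f : L2T) : ‖coeffCLM n f‖ ≤ ‖f‖ := by
  have h := norm_inner_le_norm (𝕜 := ℂ) (fourierBasis (T := 2 * π) n) f
  rwa [fourierBasis.orthonormal.1 n, one_mul] at h

theorem ext_coeffCLM {f g : L2T} (h : ∀ n, coeffCLM n f = coeffCLM n g) : f = g := by
  refine fourierBasis.repr.injective ?_
  ext n
  rw [fourierBasis_repr, fourierBasis_repr, ← coeffCLM_apply, ← coeffCLM_apply, h]

theorem sum_sq_norm_coeffCLM_le (s : Finset ℤ) (f : L2T) :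
    ∑ n ∈ s, ‖coeffCLM n f‖ ^ 2 ≤ ‖f‖ ^ 2 :=
  fourierBasis.orthonormal.sum_inner_products_le f

theorem summable_sq_norm_coeffCLM (f : L2T) : Summable fun n => ‖coeffCLM n f‖ ^ 2 :=
  summable_of_sum_le (fun _ => by positivity) fun s => sum_sq_norm_coeffCLM_le s f

theorem sq_norm_eq_tsum_coeff (f : L2T) : ‖f‖ ^ 2 = ∑' n, ‖coeffCLM n f‖ ^ 2 := by
  have h := lp.norm_rpow_eq_tsum (p := 2) (by norm_num) (fourierBasis.repr f)
  simp only [ENNReal.toReal_ofNat, Real.rpow_two, LinearIsometryEquiv.norm_map] at h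
  simp_rw [h, coeffCLM_apply, fourierBasis_repr]

theorem norm_le_norm_of_coeff {f g : L2T} (h : ∀ n, ‖coeffCLM n f‖ ≤ ‖coeffCLM n g‖) :
    ‖f‖ ≤ ‖g‖ := by
  refine (sq_le_sq₀ (norm_nonneg _) (norm_nonneg _)).1 ?_
  rw [sq_norm_eq_tsum_coeff, sq_norm_eq_tsum_coeff]
  exact (summable_sq_norm_coeffCLM f).tsum_le_tsum
    (fun n => pow_le_pow_left₀ (norm_nonneg _) (h n) 2) (summable_sq_norm_coeffCLM g)

theorem coeffCLM_rieszProj (f : L2T) (n : ℤ) :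
    coeffCLM n (rieszProj f) = if 0 ≤ n then coeffCLM n f else 0 := by
  rw [coeffCLM_apply, coeffCLM_apply, rieszProj, fourierCoeff_fourierMultiplier]
  split_ifs <;> simp

theorem coeffCLM_eq_zero_of_mem_hardyH2 {f : L2T} (hf : f ∈ hardyH2) {n : ℤ} (hn : n < 0) :
    coeffCLM n f = 0 := by
  obtain ⟨g, rfl⟩ := hf
  exact (coeffCLM_rieszProj g n).trans (if_neg hn.not_ge)

theorem coeffCLM_semigroup {t : ℝ} (ht : 0 ≤ t) (f : L2T) (n : ℤ) :
    coeffCLM n (semigroup t f) = Complex.exp (-(|(n : ℝ)| * t : ℝ)) * coeffCLM n f := by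
  rw [coeffCLM_apply, coeffCLM_apply, fourierCoeff_semigroup ht]
  push_cast
  rfl

/-- An `L²(𝕋)`-valued function is strongly measurable as soon as its Fourier coefficients are. -/
theorem aestronglyMeasurable_of_coeff {α : Type*} [MeasurableSpace α] {μ : Measure α}
    {F : α → L2T} (hF : ∀ n, AEStronglyMeasurable (fun s => coeffCLM n (F s)) μ) :
    AEStronglyMeasurable F μ := by
  refine aestronglyMeasurable_of_tendsto_ae (Filter.atTop : Filter (Finset ℤ))
    (f := fun (A : Finset ℤ) s => ∑ n ∈ A, coeffCLM n (F s) • (fourierLp 2 n : L2T))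
    (fun A => ?_) (.of_forall fun s => ?_)
  · exact Finset.aestronglyMeasurable_fun_sum A fun n _ => (hF n).smul_const _
  · have := hasSum_fourier_series_L2 (F s)
    simp_rw [← coeffCLM_apply] at this
    exact this

/-! ### Extension by zero and the input-to-output map -/

theorem coeFn_extendByZero {ω : Set Torus} (hω : MeasurableSet ω) (g : L2On ω) :
    extendByZero ω g =ᵐ[arcMeasure] ω.indicator g := by
  rw [extendByZero, dif_pos (memLp_indicator hω g)]
  exact MemLp.coeFn_toLp _

theorem norm_extendByZero {ω : Set Torus} (hω : MeasurableSet ω) (g : L2On ω) :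
    ‖extendByZero ω g‖ = ‖g‖ := by
  rw [Lp.norm_def, Lp.norm_def, eLpNorm_congr_ae (coeFn_extendByZero hω g),
    eLpNorm_indicator_eq_eLpNorm_restrict hω]

/-- Extension by zero as a linear isometry, for measurable `ω`. -/
noncomputable def extendByZeroLI {ω : Set Torus} (hω : MeasurableSet ω) :
    L2On ω →ₗᵢ[ℂ] L2T where
  toFun := extendByZero ω
  map_add' f g := by
    refine Lp.ext ?_
    filter_upwards [coeFn_extendByZero hω (f + g), coeFn_extendByZero hω f,
      coeFn_extendByZero hω g, Lp.coeFn_add (extendByZero ω f) (extendByZero ω g),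
      (ae_restrict_iff' hω).1 (Lp.coeFn_add f g)] with x h1 h2 h3 h4 h5
    rw [h1, h4, Pi.add_apply, h2, h3]
    by_cases hx : x ∈ ω
    · rw [indicator_of_mem hx, indicator_of_mem hx, indicator_of_mem hx, h5 hx, Pi.add_apply]
    · simp [hx]
  map_smul' c f := by
    refine Lp.ext ?_
    filter_upwards [coeFn_extendByZero hω (c • f), coeFn_extendByZero hω f,
      Lp.coeFn_smul c (extendByZero ω f), (ae_restrict_iff' hω).1 (Lp.coeFn_smul c f)]
      with x h1 h2 h3 h4
    simp only [RingHom.id_apply]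
    rw [h1, h3, Pi.smul_apply, h2]
    by_cases hx : x ∈ ω
    · simp [hx, h4 hx]
    · simp [hx]
  norm_map' g := norm_extendByZero hω g

theorem extendByZeroLI_apply {ω : Set Torus} (hω : MeasurableSet ω) (g : L2On ω) :
    extendByZeroLI hω g = extendByZero ω g := rfl

/-- Restriction to `ω`. -/
noncomputable def restrictCLM (ω : Set Torus) : L2T →L[ℂ] L2On ω :=
  LpToLpRestrictCLM Torus ℂ ℂ arcMeasure 2 ω

theorem extendByZero_restrictCLM {ω : Set Torus} (hω : MeasurableSet ω) {f : L2T}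
    (hf : ∀ᵐ x ∂arcMeasure, x ∉ ω → f x = 0) : extendByZero ω (restrictCLM ω f) = f := by
  refine Lp.ext ?_
  filter_upwards [coeFn_extendByZero hω (restrictCLM ω f), hf,
    (ae_restrict_iff' hω).1 (LpToLpRestrictCLM_coeFn ℂ ω f)] with x h1 h2 h3
  rw [h1]
  by_cases hx : x ∈ ω
  · rw [indicator_of_mem hx, restrictCLM, h3 hx]
  · rw [indicator_of_notMem hx, h2 hx]

theorem norm_restrictCLM_le (ω : Set Torus) (f : L2T) : ‖restrictCLM ω f‖ ≤ ‖f‖ :=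
  norm_Lp_toLp_restrict_le ω f

/-- Fourier coefficients of `∫₀ᵗ S(t - s) P₊ 𝟙_ω u(s) ds`. -/
theorem coeffCLM_inputToOutput {ω : Set Torus} (hω : MeasurableSet ω) {T t : ℝ} (u : Control ω T)
    (ht : t ∈ Icc 0 T) (n : ℤ) :
    coeffCLM n (inputToOutput ω T u t) =
      if 0 ≤ n then Complex.exp (-(n * t)) *
        ∫ s in (0 : ℝ)..t, Complex.exp (n * s) * coeffCLM n (extendByZero ω (u s)) else 0 := by
  have hμ : (volume.restrict (Ioc 0 t)) ≤ (volume.restrict (Icc 0 T) : Measure ℝ) :=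
    Measure.restrict_mono (Ioc_subset_Icc_self.trans (Icc_subset_Icc_right ht.2)) le_rfl
  have hu : Integrable u (volume.restrict (Ioc 0 t)) :=
    ((Lp.memLp u).mono_measure hμ).integrable one_le_two
  have hg : AEStronglyMeasurable (fun s => extendByZero ω (u s)) (volume.restrict (Ioc 0 t)) :=
    (extendByZeroLI hω).continuous.comp_aestronglyMeasurable hu.aestronglyMeasurable
  have hcoeff : ∀ s ∈ Ioc 0 t, ∀ n : ℤ,
      coeffCLM n (semigroup (t - s) (rieszProj (extendByZero ω (u s)))) =
        if 0 ≤ n then Complex.exp (-(n * t)) *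
          (Complex.exp (n * s) * coeffCLM n (extendByZero ω (u s))) else 0 := by
    intro s hs n
    rw [coeffCLM_semigroup (sub_nonneg.2 hs.2), coeffCLM_rieszProj]
    split_ifs with hn
    · have hn' : (0 : ℝ) ≤ n := by exact_mod_cast hn
      rw [abs_of_nonneg hn', ← mul_assoc, ← Complex.exp_add]
      push_cast
      ring_nf
    · rw [mul_zero]
  have hle : ∀ s ∈ Ioc 0 t,
      ‖semigroup (t - s) (rieszProj (extendByZero ω (u s)))‖ ≤ ‖u s‖ := by
    intro s hs
    rw [← norm_extendByZero hω (u s)]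
    refine norm_le_norm_of_coeff fun n => ?_
    rw [coeffCLM_semigroup (sub_nonneg.2 hs.2), coeffCLM_rieszProj, norm_mul,
      ← Complex.ofReal_neg, Complex.norm_exp_ofReal]
    refine (mul_le_of_le_one_left (norm_nonneg _) ?_).trans ?_
    · rw [Real.exp_le_one_iff, neg_nonpos]
      exact mul_nonneg (abs_nonneg _) (sub_nonneg.2 hs.2)
    · split_ifs
      · exact le_rfl
      · rw [norm_zero]; exact norm_nonneg _
  have hint : Integrable (fun s => semigroup (t - s) (rieszProj (extendByZero ω (u s))))
      (volume.restrict (Ioc 0 t)) := by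
    refine hu.mono (aestronglyMeasurable_of_coeff fun n => ?_)
      ((ae_restrict_iff' measurableSet_Ioc).2 (.of_forall hle))
    have : AEStronglyMeasurable (fun s : ℝ => if 0 ≤ n then Complex.exp (-(n * t)) *
          (Complex.exp (n * s) * coeffCLM n (extendByZero ω (u s))) else 0)
        (volume.restrict (Ioc 0 t)) := by
      split_ifs
      · refine AEStronglyMeasurable.const_mul (AEStronglyMeasurable.mul ?_
          ((coeffCLM n).continuous.comp_aestronglyMeasurable hg)) _
        exact Continuous.aestronglyMeasurable (by fun_prop)
      · exact aestronglyMeasurable_const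
    refine this.congr ((ae_restrict_iff' measurableSet_Ioc).2 (.of_forall fun s hs => ?_))
    exact (hcoeff s hs n).symm
  rw [inputToOutput, intervalIntegral.integral_of_le ht.1, ← (coeffCLM n).integral_comp_comm hint,
    setIntegral_congr_fun measurableSet_Ioc fun s hs => hcoeff s hs n,
    intervalIntegral.integral_of_le ht.1]
  split_ifs
  · rw [integral_const_mul]
  · simp

/-! ### The backward transport equation -/

/-- The `n`-th Fourier coefficient of the solution on `[0, ∞)` of `(∂ₜ - i ∂ₓ) h = g` which
vanishes at time `T`; here `γ n` is the `n`-th coefficient of the source `g`. It is extended to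
negative times by its value at `0`. -/
noncomputable def backwardCoeff (T : ℝ) (γ : ℤ → ℝ → ℂ) (n : ℤ) (t : ℝ) : ℂ :=
  Complex.exp (-n * (max t 0 : ℝ)) * (-(∫ s in (0 : ℝ)..T, Complex.exp (n * s) * γ n s) +
    ∫ s in (0 : ℝ)..max t 0, Complex.exp (n * s) * γ n s)

section backward

variable {T : ℝ} {γ : ℤ → ℝ → ℂ} {n : ℤ}

theorem intervalIntegrable_exp_mul (hγ : Integrable (γ n)) (a b : ℝ) :
    IntervalIntegrable (fun s : ℝ => Complex.exp (n * s) * γ n s) volume a b :=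
  hγ.intervalIntegrable.continuousOn_mul (Continuous.continuousOn (by fun_prop))

theorem backwardCoeff_of_nonneg {t : ℝ} (ht : 0 ≤ t) :
    backwardCoeff T γ n t = Complex.exp (-n * t) *
      (-(∫ s in (0 : ℝ)..T, Complex.exp (n * s) * γ n s) +
        ∫ s in (0 : ℝ)..t, Complex.exp (n * s) * γ n s) := by
  rw [backwardCoeff, max_eq_left ht]

theorem backwardCoeff_zero :
    backwardCoeff T γ n 0 = -∫ s in (0 : ℝ)..T, Complex.exp (n * s) * γ n s := by
  simp [backwardCoeff]

theorem continuous_backwardCoeff (hγ : Integrable (γ n)) :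
    Continuous (backwardCoeff T γ n) := by
  have h : Continuous fun t : ℝ => ∫ s in (0 : ℝ)..t, Complex.exp (n * s) * γ n s :=
    intervalIntegral.continuous_primitive (intervalIntegrable_exp_mul hγ) 0
  have h' := h.comp (continuous_id.max (continuous_const (y := (0 : ℝ))))
  simp only [Function.comp_def, id] at h'
  unfold backwardCoeff
  fun_prop

theorem backwardCoeff_eq_neg_integral (hγ : Integrable (γ n)) {t : ℝ} (ht : 0 ≤ t) :
    backwardCoeff T γ n t =
      -∫ s in t..T, Complex.exp (-n * t) * (Complex.exp (n * s) * γ n s) := by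
  have h := intervalIntegral.integral_add_adjacent_intervals
    (intervalIntegrable_exp_mul hγ 0 t) (intervalIntegrable_exp_mul hγ t T)
  rw [backwardCoeff_of_nonneg ht, ← h, intervalIntegral.integral_const_mul]
  ring

theorem backwardCoeff_of_le (hγ : Integrable (γ n)) (hT : 0 ≤ T)
    (hsupp : ∀ s, s ∉ Icc 0 T → γ n s = 0) {t : ℝ} (ht : T ≤ t) : backwardCoeff T γ n t = 0 := by
  rw [backwardCoeff_eq_neg_integral hγ (hT.trans ht), intervalIntegral.integral_symm, neg_neg,
    intervalIntegral.integral_of_le ht]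
  refine setIntegral_eq_zero_of_forall_eq_zero fun s hs => ?_
  rw [hsupp s fun h => hs.1.not_ge h.2, mul_zero, mul_zero]

theorem backwardCoeff_sub (hγ : Integrable (γ n)) {t : ℝ} (ht : 0 ≤ t) :
    backwardCoeff T γ n t - backwardCoeff T γ n 0 =
      ∫ s in (0 : ℝ)..t, (-n * backwardCoeff T γ n s + γ n s) := by
  have hd : ∀ s : ℝ, HasDerivAt (fun s : ℝ => Complex.exp (-n * s))
      (-n * Complex.exp (-n * s)) s := fun s => by
    have h1 : HasDerivAt (fun y : ℝ => Complex.exp (-(n : ℂ) * y))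
        (Complex.exp (-(n : ℂ) * s) * (-(n : ℂ) * 1)) s :=
      ((Complex.ofRealCLM.hasDerivAt (x := s)).const_mul (-(n : ℂ))).cexp
    exact h1.congr_deriv (by ring)
  have h := integral_deriv_mul_primitive ht
    (-(∫ s in (0 : ℝ)..T, Complex.exp (n * s) * γ n s)) (intervalIntegrable_exp_mul hγ 0 t) hd
    (by fun_prop)
  rw [backwardCoeff_of_nonneg ht, backwardCoeff_zero]
  simp only [Complex.ofReal_zero, mul_zero, Complex.exp_zero, one_mul] at h
  rw [← h]
  refine intervalIntegral.integral_congr fun s hs => ?_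
  rw [uIcc_of_le ht] at hs
  rw [backwardCoeff_of_nonneg hs.1, ← mul_assoc (Complex.exp _) _ (γ n s), ← Complex.exp_add]
  simp only [neg_mul, neg_add_cancel, Complex.exp_zero, one_mul]
  ring

/-- Multiplying `h` by the cutoff `1 - t / T₁` gives a solution with source
`(1 - t / T₁) g - h / T₁`, which goes from the same initial value to zero in time `T₁`. -/
theorem integral_cutoff_source (hγ : Integrable (γ n)) {T₁ : ℝ} (hT₁ : 0 < T₁) :
    ∫ s in (0 : ℝ)..T₁, Complex.exp (n * s) *
        ((1 - s / T₁ : ℝ) * γ n s - (1 / T₁ : ℝ) * backwardCoeff T γ n s) =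
      ∫ s in (0 : ℝ)..T, Complex.exp (n * s) * γ n s := by
  have hd : ∀ s : ℝ, HasDerivAt (fun s : ℝ => ((1 - s / T₁ : ℝ) : ℂ)) (-(1 / T₁ : ℝ) : ℂ) s :=
    fun s => by
      have := (((hasDerivAt_id s).div_const T₁).const_sub 1).ofReal_comp
      exact this.congr_deriv (by simp)
  have h := integral_deriv_mul_primitive hT₁.le
    (-(∫ s in (0 : ℝ)..T, Complex.exp (n * s) * γ n s)) (intervalIntegrable_exp_mul hγ 0 T₁) hd
    continuous_const
  simp only [div_self hT₁.ne', sub_self, Complex.ofReal_zero, zero_mul, zero_div, sub_zero,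
    Complex.ofReal_one, one_mul, zero_sub, neg_neg] at h
  rw [← h]
  refine intervalIntegral.integral_congr fun s hs => ?_
  rw [uIcc_of_le hT₁.le] at hs
  rw [backwardCoeff_of_nonneg hs.1, mul_sub, mul_left_comm _ ((1 / T₁ : ℝ) : ℂ), ← mul_assoc
    (Complex.exp _) (Complex.exp _), ← Complex.exp_add]
  simp only [neg_mul, add_neg_cancel, Complex.exp_zero, one_mul]
  ring

/-- Frequencies `n < 0` are integrated backward from `T`, frequencies `n ≥ 0` forward from the
initial value, so that only decaying exponentials occur. -/
theorem norm_backwardCoeff_le (hγ : Integrable (γ n)) (hT : 0 ≤ T)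
    (hsupp : ∀ s, s ∉ Icc 0 T → γ n s = 0) {A : ℝ} (hA : 0 ≤ A)
    (h0 : 0 ≤ n → ‖backwardCoeff T γ n 0‖ ≤ A) (t : ℝ) :
    ‖backwardCoeff T γ n t‖ ≤ A + ∫ s, ‖γ n s‖ := by
  wlog ht : 0 ≤ t generalizing t
  · have h := this 0 le_rfl
    rwa [show backwardCoeff T γ n 0 = backwardCoeff T γ n t by
      simp [backwardCoeff, max_eq_right (not_le.1 ht).le]] at h
  have hI : 0 ≤ ∫ s, ‖γ n s‖ := integral_nonneg fun _ => norm_nonneg _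
  have hexp : ∀ s : ℝ, ‖Complex.exp (-n * t) * (Complex.exp (n * s) * γ n s)‖ =
      Real.exp (n * (s - t)) * ‖γ n s‖ := fun s => by
    rw [← mul_assoc, ← Complex.exp_add, norm_mul,
      show (-n * t + n * s : ℂ) = ((n * (s - t) : ℝ) : ℂ) by push_cast; ring,
      Complex.norm_exp_ofReal]
  have hbd : ∀ a b : ℝ, a ≤ b → (∀ s ∈ Ioc a b, (n : ℝ) * (s - t) ≤ 0) →
      ‖∫ s in a..b, Complex.exp (-n * t) * (Complex.exp (n * s) * γ n s)‖ ≤ ∫ s, ‖γ n s‖ := by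
    intro a b hab hs
    calc _ ≤ ∫ s in a..b, ‖γ n s‖ := by
          refine intervalIntegral.norm_integral_le_of_norm_le hab (.of_forall fun s hs' => ?_)
            hγ.norm.intervalIntegrable
          rw [hexp]
          exact mul_le_of_le_one_left (norm_nonneg _) (Real.exp_le_one_iff.2 (hs s hs'))
      _ ≤ _ := by
          rw [intervalIntegral.integral_of_le hab]
          exact setIntegral_le_integral hγ.norm (.of_forall fun _ => norm_nonneg _)
  rcases le_or_gt T t with hTt | hTt
  · rw [backwardCoeff_of_le hγ hT hsupp hTt, norm_zero]
    positivity
  rcases lt_or_ge n 0 with hn | hn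
  · have hn' : (n : ℝ) ≤ 0 := by exact_mod_cast hn.le
    rw [backwardCoeff_eq_neg_integral hγ ht, norm_neg]
    refine (hbd t T hTt.le fun s hs => ?_).trans (le_add_of_nonneg_left hA)
    exact mul_nonpos_of_nonpos_of_nonneg hn' (sub_nonneg.2 hs.1.le)
  · have hn' : (0 : ℝ) ≤ n := by exact_mod_cast hn
    rw [backwardCoeff_of_nonneg ht, mul_add, ← intervalIntegral.integral_const_mul,
      ← backwardCoeff_zero (T := T)]
    refine (norm_add_le _ _).trans (add_le_add ?_ (hbd 0 t ht fun s hs => ?_))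
    · rw [norm_mul, show (-n * t : ℂ) = ((-(n * t) : ℝ) : ℂ) by push_cast; ring,
        Complex.norm_exp_ofReal]
      refine (mul_le_of_le_one_left (norm_nonneg _) ?_).trans (h0 hn)
      rw [Real.exp_le_one_iff, neg_nonpos]
      positivity
    · exact mul_nonpos_of_nonneg_of_nonpos hn' (sub_nonpos.2 hs.2)

end backward

/-- A sequence dominated by a square summable one is the sequence of coefficients of a
function. -/
theorem exists_coeffCLM_eq {B : ℤ → ℝ} (hB : Summable fun n => B n ^ 2) {c : ℤ → ℂ}
    (hc : ∀ n, ‖c n‖ ≤ B n) :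
    ∃ f : L2T, (∀ n, coeffCLM n f = c n) ∧ ‖f‖ ^ 2 ≤ ∑' n, B n ^ 2 := by
  have hle : ∀ n, ‖c n‖ ^ 2 ≤ B n ^ 2 := fun n => pow_le_pow_left₀ (norm_nonneg _) (hc n) 2
  have hs : Summable fun n => ‖c n‖ ^ 2 := hB.of_nonneg_of_le (fun n => by positivity) hle
  have hm : Memℓp c 2 := memℓp_gen (by simpa using hs)
  have hcoef : ∀ n, coeffCLM n (fourierBasis.repr.symm ⟨c, hm⟩) = c n := fun n => by
    rw [coeffCLM_apply, ← fourierBasis_repr, LinearIsometryEquiv.apply_symm_apply]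
  refine ⟨_, hcoef, ?_⟩
  rw [sq_norm_eq_tsum_coeff]
  simp_rw [hcoef]
  exact hs.tsum_le_tsum hle hB

theorem sq_integral_norm_le {f : ℝ → ℂ} {T : ℝ} (hT : 0 < T) (hf : Integrable f)
    (hf2 : Integrable fun s => ‖f s‖ ^ 2) (hsupp : ∀ s, s ∉ Icc 0 T → f s = 0) :
    (∫ s, ‖f s‖) ^ 2 ≤ T * ∫ s, ‖f s‖ ^ 2 := by
  have e1 : ∫ s, ‖f s‖ = ∫ s in Icc 0 T, ‖f s‖ :=
    (setIntegral_eq_integral_of_forall_compl_eq_zero fun s hs => by simp [hsupp s hs]).symm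
  have e2 : ∫ s, ‖f s‖ ^ 2 = ∫ s in Icc 0 T, ‖f s‖ ^ 2 :=
    (setIntegral_eq_integral_of_forall_compl_eq_zero fun s hs => by simp [hsupp s hs]).symm
  rw [e1, e2]
  set m := ∫ s in Icc 0 T, ‖f s‖ with hm
  -- Expand `∫ (T ‖f‖ - m)² ≥ 0` over `[0, T]`.
  have hvar : 0 ≤ ∫ s in Icc 0 T, (T * ‖f s‖ - m) ^ 2 := integral_nonneg fun _ => sq_nonneg _
  have hexp : ∀ s, (T * ‖f s‖ - m) ^ 2 = T ^ 2 * ‖f s‖ ^ 2 - (2 * T * m) * ‖f s‖ + m ^ 2 :=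
    fun s => by ring
  simp_rw [hexp] at hvar
  rw [integral_add, integral_sub, integral_const_mul, integral_const_mul, ← hm,
    setIntegral_const, Measure.real, Real.volume_Icc, sub_zero, ENNReal.toReal_ofReal hT.le,
    smul_eq_mul] at hvar
  · have : 0 ≤ T * (T * (∫ s in Icc 0 T, ‖f s‖ ^ 2) - m ^ 2) := by linarith
    linarith [nonneg_of_mul_nonneg_right this hT]
  · exact hf2.restrict.const_mul _
  · exact hf.norm.restrict.const_mul _
  · exact (hf2.restrict.const_mul _).sub (hf.norm.restrict.const_mul _)
  · exact integrable_const _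

/-- The `L¹` norms in time of the Fourier coefficients of a source are square summable. -/
theorem summable_sq_integral_coeff {g : ℝ → L2T} {T : ℝ} (hT : 0 < T) (hg : Integrable g)
    (hg2 : Integrable fun s => ‖g s‖ ^ 2) (hsupp : ∀ s, s ∉ Icc 0 T → g s = 0) :
    Summable fun n => (∫ s, ‖coeffCLM n (g s)‖) ^ 2 := by
  have hgn : ∀ n, Integrable fun s => coeffCLM n (g s) := fun n =>
    (coeffCLM n).integrable_comp hg
  have hgn2 : ∀ n, Integrable fun s => ‖coeffCLM n (g s)‖ ^ 2 := fun n =>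
    hg2.mono ((hgn n).aestronglyMeasurable.norm.pow 2) (.of_forall fun s => by
      rw [Real.norm_of_nonneg (by positivity), Real.norm_of_nonneg (by positivity)]
      exact pow_le_pow_left₀ (norm_nonneg _) (norm_coeffCLM_le n _) 2)
  have hs : Summable fun n => ∫ s, ‖coeffCLM n (g s)‖ ^ 2 := by
    refine summable_of_sum_le (c := ∫ s, ‖g s‖ ^ 2)
      (fun n => integral_nonneg fun _ => by positivity) fun A => ?_
    rw [← integral_finsetSum A fun n _ => hgn2 n]
    exact integral_mono (integrable_finsetSum A fun n _ => hgn2 n) hg2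
      fun s => sum_sq_norm_coeffCLM_le A (g s)
  refine (hs.mul_left T).of_nonneg_of_le (fun n => by positivity) fun n => ?_
  exact sq_integral_norm_le hT (hgn n) (hgn2 n) fun s hs => by rw [hsupp s hs, map_zero]

/-! ### Support of the backward solution -/

/-- Let `h` be the solution of `(∂ₜ - i ∂ₓ) h = g` which vanishes for `t ≥ T`, with `g` supported
in `ω`. At positive times `h` vanishes off the closure of `ω`, since it is holomorphic in `x + i t`
there. -/
theorem backward_eq_zero_off_closure {ω : Set Torus} {g H : ℝ → L2T} {T M : ℝ} (hT : 0 ≤ T)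
    (hg : Integrable g) (hsupp : ∀ s, s ∉ Icc 0 T → g s = 0)
    (hgω : ∀ s, ∀ᵐ x ∂arcMeasure, x ∉ ω → g s x = 0)
    (hH : ∀ t n, coeffCLM n (H t) = backwardCoeff T (fun n s => coeffCLM n (g s)) n t)
    (hM : ∀ t, ‖H t‖ ≤ M) {t : ℝ} (ht : 0 < t) :
    ∀ᵐ x ∂arcMeasure, x ∈ (closure ω)ᶜ → H t x = 0 := by
  refine ae_eq_zero_of_integral_test_eq_zero isClosed_closure.isOpen_compl _ fun q hq hqc hqs => ?_
  set U := (fun y : ℝ => (y : Torus)) ⁻¹' (closure ω)ᶜ ∩ Ioo 0 (2 * π) with hU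
  have hUo : IsOpen U :=
    (isClosed_closure.isOpen_compl.preimage (AddCircle.continuous_mk' _)).inter isOpen_Ioo
  obtain ⟨η, hη, hηU⟩ := hqc.isCompact.exists_thickening_subset_open hUo hqs
  have htrans : ∀ x : ℝ, |x| < η → Function.support (fun y => q (y - x)) ⊆ U := by
    intro x hx y hy
    refine hηU (Metric.mem_thickening_iff.2 ⟨y - x, subset_tsupport q hy, ?_⟩)
    rwa [Real.dist_eq, sub_sub_cancel]
  have hUI : U ⊆ Ioc 0 (2 * π) := inter_subset_right.trans Ioo_subset_Ioc_self
  have hgn : ∀ n, Integrable fun s => coeffCLM n (g s) := fun n =>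
    (coeffCLM n).integrable_comp hg
  obtain ⟨ha, ha'⟩ := summable_coeff_of_contDiff hq hqc
  have hpair := (hasSum_pairing (H t) hq.continuous ((subset_tsupport q).trans (hqs.trans hUI)))
  rw [← hpair.tsum_eq]
  simp_rw [← coeffCLM_apply, hH]
  refine tsum_eq_zero_of_transport (G := fun s => ‖g s‖) (M := M) (T := T) hη
    (fun n => continuous_backwardCoeff (hgn n)) (fun n s => ?_) (fun n s hs => ?_)
    (fun n => (hgn n).aestronglyMeasurable) hg.norm (fun n s => norm_coeffCLM_le n (g s))
    (fun n s hs => backwardCoeff_sub (hgn n) hs) ha ha' (fun x hx s => ?_) ht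
  · rw [← hH]
    exact (norm_coeffCLM_le n _).trans (hM s)
  · exact backwardCoeff_of_le (hgn n) hT (fun r hr => by rw [hsupp r hr, map_zero]) hs
  · have h := hasSum_pairing (g s) (q := fun y => q (y - x)) (hq.continuous.comp (by fun_prop))
      ((htrans x hx).trans hUI)
    simp_rw [integral_translate_mul_exp, ← coeffCLM_apply,
      mul_right_comm _ (Complex.exp _) (coeffCLM _ (g s))] at h
    rw [h.tsum_eq]
    refine integral_eq_zero_of_ae ?_
    filter_upwards [ae_coe_of_ae (hgω s)] with y hy
    by_cases hqy : q (y - x) = 0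
    · simp [hqy]
    · have hyU := htrans x hx hqy
      have hyω : (y : Torus) ∉ ω := fun h => hyU.1 (subset_closure h)
      simp [hy (hUI hyU) hyω]

/-! ### Shortening the control time -/

/-- With `T₁ = min T T'`, the null-control `u` in time `T` yields the null-control `θ u - h / T₁`
in time `T'`, where `h` is the backward solution with source `𝟙_ω u`, supported in `ω`, and `θ`
decreases linearly from `1` to `0` on `[0, T₁]`. After `T₁` the control is zero. -/
theorem exists_control_of_null_control {ω : Set Torus} (hω : MeasurableSet ω)
    (hcl : ∀ᵐ x ∂arcMeasure, x ∈ closure ω → x ∈ ω) {T : ℝ} (hT : 0 < T) {f₀ : L2T}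
    (hf₀ : f₀ ∈ hardyH2) (u : Control ω T)
    (hu : semigroup T f₀ + inputToOutput ω T u T = 0) :
    ∃ C : ℝ, 0 < C ∧ ∀ T' : ℝ, 0 < T' → ∃ v : Control ω T',
      semigroup T' f₀ + inputToOutput ω T' v T' = 0 ∧ ‖v‖ ≤ C * max 1 T'⁻¹ := by
  set U : ℝ → L2On ω := (Icc 0 T).indicator u with hUdef
  have hUL : MemLp U 2 volume := (memLp_indicator_iff_restrict measurableSet_Icc).2 (Lp.memLp u)
  have hU0 : ∀ s, s ∉ Icc 0 T → U s = 0 := fun s hs => indicator_of_notMem hs _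
  have hUi : Integrable U :=
    (integrable_indicator_iff measurableSet_Icc).2 ((Lp.memLp u).integrable one_le_two)
  set g : ℝ → L2T := fun s => extendByZeroLI hω (U s) with hgdef
  have hgi : Integrable g := (extendByZeroLI hω).toContinuousLinearMap.integrable_comp hUi
  have hgn : ∀ n, Integrable fun s => coeffCLM n (g s) := fun n =>
    (coeffCLM n).integrable_comp hgi
  have hg2 : Integrable fun s => ‖g s‖ ^ 2 := by
    simp only [hgdef, LinearIsometry.norm_map]
    exact hUL.integrable_norm_pow two_ne_zero
  have hg0 : ∀ s, s ∉ Icc 0 T → g s = 0 := fun s hs => by simp only [hgdef, hU0 s hs, map_zero]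
  have hgω : ∀ s, ∀ᵐ x ∂arcMeasure, x ∉ ω → g s x = 0 := fun s => by
    filter_upwards [coeFn_extendByZero hω (U s)] with x hx hxω
    simp only [hgdef, extendByZeroLI_apply, hx, indicator_of_notMem hxω]
  set γ : ℤ → ℝ → ℂ := fun n s => coeffCLM n (g s) with hγ
  have hγ0 : ∀ n s, s ∉ Icc 0 T → γ n s = 0 := fun n s hs => by simp only [hγ, hg0 s hs, map_zero]
  -- Null-controllability prescribes the nonnegative frequencies of the initial value.
  have hmoment : ∀ n : ℤ, 0 ≤ n →
      coeffCLM n f₀ = -∫ s in (0 : ℝ)..T, Complex.exp (n * s) * γ n s := by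
    intro n hn
    have h := congrArg (coeffCLM n) hu
    rw [map_add, coeffCLM_inputToOutput hω u ⟨hT.le, le_rfl⟩, coeffCLM_semigroup hT.le, if_pos hn,
      map_zero] at h
    have hn' : (0 : ℝ) ≤ n := by exact_mod_cast hn
    have he : (-(|(n : ℝ)| * T : ℝ) : ℂ) = -(n * T) := by rw [abs_of_nonneg hn']; push_cast; ring
    have hc : ∫ s in (0 : ℝ)..T, Complex.exp (n * s) * coeffCLM n (extendByZero ω (u s)) =
        ∫ s in (0 : ℝ)..T, Complex.exp (n * s) * γ n s := by
      refine intervalIntegral.integral_congr fun s hs => ?_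
      rw [uIcc_of_le hT.le] at hs
      simp only [hγ, hgdef, hUdef, indicator_of_mem hs, extendByZeroLI_apply]
    rw [he, hc, ← mul_add] at h
    exact eq_neg_of_add_eq_zero_left ((mul_eq_zero.1 h).resolve_left (Complex.exp_ne_zero _))
  -- The backward solution.
  have hB : Summable fun n => (‖coeffCLM n f₀‖ + ∫ s, ‖γ n s‖) ^ 2 := by
    refine (((summable_sq_norm_coeffCLM f₀).add
      (summable_sq_integral_coeff hT hgi hg2 hg0)).mul_left 2).of_nonneg_of_le
      (fun n => by positivity) fun n => add_sq_le
  choose H hHc hHn using fun t => exists_coeffCLM_eq hB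
    (c := fun n => backwardCoeff T γ n t) fun n => norm_backwardCoeff_le (hgn n) hT.le (hγ0 n)
      (norm_nonneg (coeffCLM n f₀)) (fun hn => by rw [backwardCoeff_zero, ← hmoment n hn]) t
  set M := Real.sqrt (∑' n, (‖coeffCLM n f₀‖ + ∫ s, ‖γ n s‖) ^ 2) with hMdef
  have hHM : ∀ t, ‖H t‖ ≤ M := fun t => Real.le_sqrt_of_sq_le (hHn t)
  have hHω : ∀ t, 0 < t → extendByZero ω (restrictCLM ω (H t)) = H t := by
    intro t ht
    refine extendByZero_restrictCLM hω ?_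
    filter_upwards [backward_eq_zero_off_closure hT.le hgi hg0 hgω hHc hHM ht, hcl]
      with x hx hx' hxω
    exact hx fun h => hxω (hx' h)
  have hHm : AEStronglyMeasurable H volume := aestronglyMeasurable_of_coeff fun n => by
    simp_rw [hHc]
    exact (continuous_backwardCoeff (hgn n)).aestronglyMeasurable
  set k : ℝ → L2On ω := (Icc 0 T).indicator fun s => restrictCLM ω (H s) with hk
  have hkL : MemLp k 2 volume := by
    refine (memLp_indicator_iff_restrict measurableSet_Icc).2 ?_
    refine MemLp.of_bound ((restrictCLM ω).continuous.comp_aestronglyMeasurable hHm).restrict M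
      (.of_forall fun s => (norm_restrictCLM_le ω _).trans (hHM s))
  set N := (eLpNorm (fun s => ‖U s‖ + ‖k s‖) 2 volume).toReal with hN
  have hNL : MemLp (fun s => ‖U s‖ + ‖k s‖) 2 volume := hUL.norm.add hkL.norm
  have hN0 : 0 ≤ N := ENNReal.toReal_nonneg
  refine ⟨(2 + T⁻¹) * N + 1, by positivity, fun T' hT' => ?_⟩
  set T₁ := min T T' with hT₁def
  have hT₁ : 0 < T₁ := lt_min hT hT'
  set v : ℝ → L2On ω := (Icc 0 T₁).indicator fun s =>
    ((1 - s / T₁ : ℝ) : ℂ) • U s - ((1 / T₁ : ℝ) : ℂ) • k s with hv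
  have hvm : AEStronglyMeasurable v volume := by
    refine AEStronglyMeasurable.indicator ?_ measurableSet_Icc
    refine AEStronglyMeasurable.fun_sub (AEStronglyMeasurable.fun_smul ?_ hUL.1) (hkL.1.fun_const_smul _)
    exact Continuous.aestronglyMeasurable (by fun_prop)
  have hvn : ∀ s, ‖v s‖ ≤ (1 + T₁⁻¹) * ‖‖U s‖ + ‖k s‖‖ := by
    intro s
    have hi : 0 ≤ T₁⁻¹ := by positivity
    rw [Real.norm_of_nonneg (by positivity)]
    by_cases hs : s ∈ Icc 0 T₁
    · rw [hv, indicator_of_mem hs]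
      refine (norm_sub_le _ _).trans ?_
      rw [norm_smul, norm_smul, Complex.norm_real, Complex.norm_real, Real.norm_of_nonneg
        (sub_nonneg.2 ((div_le_one hT₁).2 hs.2)), Real.norm_of_nonneg (by positivity), one_div]
      have h1 : (1 - s / T₁) ≤ 1 := sub_le_self _ (div_nonneg hs.1 hT₁.le)
      have h2 := mul_le_mul_of_nonneg_right h1 (norm_nonneg (U s))
      nlinarith [norm_nonneg (U s), norm_nonneg (k s), mul_nonneg hi (norm_nonneg (U s))]
    · rw [hv, indicator_of_notMem hs, norm_zero]
      positivity
  have hvL : MemLp v 2 (volume.restrict (Icc 0 T')) :=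
    (hNL.of_le_mul hvm (.of_forall hvn)).restrict _
  refine ⟨hvL.toLp v, ?_, ?_⟩
  · refine ext_coeffCLM fun n => ?_
    rw [map_add, coeffCLM_inputToOutput hω _ ⟨hT'.le, le_rfl⟩, coeffCLM_semigroup hT'.le, map_zero]
    rcases lt_or_ge n 0 with hn | hn
    · rw [if_neg hn.not_ge, coeffCLM_eq_zero_of_mem_hardyH2 hf₀ hn, mul_zero, add_zero]
    have hn' : (0 : ℝ) ≤ n := by exact_mod_cast hn
    have he : (-(|(n : ℝ)| * T' : ℝ) : ℂ) = -(n * T') := by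
      rw [abs_of_nonneg hn']; push_cast; ring
    rw [if_pos hn, he, ← mul_add]
    refine mul_eq_zero_of_right _ ?_
    have hfull : ∫ s in (0 : ℝ)..T', Complex.exp (n * s) *
        coeffCLM n (extendByZero ω (hvL.toLp v s)) =
        ∫ s in (0 : ℝ)..T', (Ioc 0 T₁).indicator (fun s : ℝ => Complex.exp (n * s) *
          ((1 - s / T₁ : ℝ) * γ n s - (1 / T₁ : ℝ) * backwardCoeff T γ n s)) s := by
      refine intervalIntegral.integral_congr_ae ?_
      filter_upwards [(ae_restrict_iff' measurableSet_Icc).1 hvL.coeFn_toLp] with s hs hs'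
      rw [uIoc_of_le hT'.le] at hs'
      rw [hs (Ioc_subset_Icc_self hs'), hv]
      by_cases hs1 : s ∈ Ioc 0 T₁
      · have hsT : s ∈ Icc 0 T := ⟨hs1.1.le, hs1.2.trans (min_le_left _ _)⟩
        rw [indicator_of_mem (Ioc_subset_Icc_self hs1), indicator_of_mem hs1,
          ← extendByZeroLI_apply hω, map_sub, map_smul, map_smul, map_sub, map_smul, map_smul, hk,
          indicator_of_mem hsT, extendByZeroLI_apply hω (restrictCLM ω (H s)), hHω s hs1.1, hHc]
        rfl
      · rw [indicator_of_notMem (fun h => hs1 ⟨hs'.1, h.2⟩), indicator_of_notMem hs1,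
          ← extendByZeroLI_apply hω, map_zero, map_zero, mul_zero]
    rw [hfull, intervalIntegral.integral_of_le hT'.le, setIntegral_indicator measurableSet_Ioc,
      inter_eq_self_of_subset_right (Ioc_subset_Ioc_right (min_le_right T T')),
      ← intervalIntegral.integral_of_le hT₁.le, integral_cutoff_source (hgn n) hT₁, hmoment n hn,
      neg_add_cancel]
  · have h1 : ‖hvL.toLp v‖ ≤ (1 + T₁⁻¹) * N := by
      rw [Lp.norm_toLp, hN]
      have h := eLpNorm_le_mul_eLpNorm_of_ae_le_mul (μ := (volume : Measure ℝ)) (p := 2)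
        (f := v) (g := fun s => ‖U s‖ + ‖k s‖) (.of_forall hvn)
      have h' := (eLpNorm_mono_measure v (Measure.restrict_le_self (s := Icc 0 T'))).trans h
      refine (ENNReal.toReal_mono
        (ENNReal.mul_ne_top ENNReal.ofReal_ne_top hNL.2.ne) h').trans_eq ?_
      rw [ENNReal.toReal_mul, ENNReal.toReal_ofReal (by positivity)]
    have h2 : T₁⁻¹ ≤ T⁻¹ + T'⁻¹ := by
      have a1 : 0 < T⁻¹ := inv_pos.2 hT
      have a2 : 0 < T'⁻¹ := inv_pos.2 hT'
      rcases min_choice T T' with h | h <;> rw [hT₁def, h] <;> linarith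
    -- `1 + 1 / T₁ ≤ 1 + 1 / T + 1 / T'`, and both `1` and `1 / T'` are at most `max 1 (1 / T')`.
    have h3 : 1 + T₁⁻¹ ≤ (2 + T⁻¹) * max 1 T'⁻¹ := by
      have a1 : 0 < T⁻¹ := inv_pos.2 hT
      nlinarith [le_max_left 1 T'⁻¹, le_max_right 1 T'⁻¹]
    have h4 : (1 : ℝ) ≤ max 1 T'⁻¹ := le_max_left _ _
    calc ‖hvL.toLp v‖ ≤ (1 + T₁⁻¹) * N := h1
      _ ≤ (2 + T⁻¹) * max 1 T'⁻¹ * N := mul_le_mul_of_nonneg_right h3 hN0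
      _ ≤ ((2 + T⁻¹) * N + 1) * max 1 T'⁻¹ := by linarith

theorem mem_NCH2_iff {ω : Set Torus} {T : ℝ} (hT : 0 < T) {f₀ : L2T} :
    f₀ ∈ NCH2 ω T ↔ f₀ ∈ hardyH2 ∧
      ∃ u : Control ω T, semigroup T f₀ + inputToOutput ω T u T = 0 := by
  refine and_congr_right fun _ => exists_congr fun u => ⟨?_, fun h => ?_⟩
  · rintro ⟨f, hf, hfT⟩
    rw [← hf T ⟨hT.le, le_rfl⟩, hfT]
  · exact ⟨fun t => semigroup t f₀ + inputToOutput ω T u t, fun t _ => rfl, h⟩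

theorem max_one_inv_le {t : ℝ} (ht : 0 < t) : max 1 t⁻¹ ≤ max 1 (t ^ (-(3 / 2) : ℝ)) := by
  rcases le_or_gt 1 t with h | h
  · rw [max_eq_left (inv_le_one_of_one_le₀ h)]
    exact le_max_left _ _
  · refine max_le (le_max_left _ _) (le_max_of_le_right ?_)
    rw [← Real.rpow_neg_one]
    exact Real.rpow_le_rpow_of_exponent_ge ht h.le (by norm_num)

end HalfHeat

theorem mainTheorem2 (ω : Set HalfHeat.Torus) (hω : IsConnected ω) :
    (∀ T T' : ℝ, 0 < T → 0 < T' → HalfHeat.NCH2 ω T = HalfHeat.NCH2 ω T') ∧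
    (∀ T : ℝ, 0 < T → ∀ f₀ ∈ HalfHeat.NCH2 ω T,
      ∃ C : ℝ, 0 < C ∧ ∀ T' : ℝ, 0 < T' →
        ∃ u : HalfHeat.Control ω T',
          HalfHeat.semigroup T' f₀ + HalfHeat.inputToOutput ω T' u T' = 0 ∧
          ‖u‖ ≤ C * max 1 (T' ^ (-(3 / 2) : ℝ))) := by
  obtain ⟨hm, hcl⟩ := HalfHeat.measurableSet_and_ae_closure hω
  have hsub : ∀ T T' : ℝ, 0 < T → 0 < T' → HalfHeat.NCH2 ω T ⊆ HalfHeat.NCH2 ω T' := by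
    intro T T' hT hT' f₀ hf₀
    obtain ⟨h1, u, hu⟩ := (HalfHeat.mem_NCH2_iff hT).1 hf₀
    obtain ⟨C, -, hC⟩ := HalfHeat.exists_control_of_null_control hm hcl hT h1 u hu
    obtain ⟨v, hv, -⟩ := hC T' hT'
    exact (HalfHeat.mem_NCH2_iff hT').2 ⟨h1, v, hv⟩
  refine ⟨fun T T' hT hT' => (hsub T T' hT hT').antisymm (hsub T' T hT' hT), ?_⟩
  intro T hT f₀ hf₀
  obtain ⟨h1, u, hu⟩ := (HalfHeat.mem_NCH2_iff hT).1 hf₀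
  obtain ⟨C, hC0, hC⟩ := HalfHeat.exists_control_of_null_control hm hcl hT h1 u hu
  refine ⟨C, hC0, fun T' hT' => ?_⟩
  obtain ⟨v, hv, hvn⟩ := hC T' hT'
  exact ⟨v, hv, hvn.trans (mul_le_mul_of_nonneg_left (HalfHeat.max_one_inv_le hT') hC0.le)⟩
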